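/- For a discrete group $\pi$, let $l^2(\pi)$ be the Hilbert space of square-summable functions $\pi\to\mathbb C$. A matrix $A\in M(d\times d,\mathbb Z\pi)$ acts on $l^2(\pi)^d$ by multiplication from the left; write $A^*$ for the adjoint of this bounded operator. Let $e_k\in l^2(\pi)^d$ ($1\le k\le d$) be the vector with $k$-th entry $\delta_1$ and other entries $0$, and let $\operatorname{tr}_\pi(T)=\sum_{k}(Te_k,e_k)$ be the von Neumann trace. For a positive operator $\Delta=A^*A$ let $F_\Delta(\lambda)=\operatorname{tr}_\pi\chi_{[0,\lambda]}(\Delta)$ be its spectral density function and $$\ln\operatorname{Det}_\pi(\Delta)=\begin{cases}\int_{0^+}^\infty\ln(\lambda)\,dF_\Delta(\lambda)&\text{if the integral converges,}\\-\infty&\text{otherwise.}\end{cases}$$ Let $Wh(\pi)=K_1(\mathbb Z\pi)/\{\pm g: g\in\pi\}$ be the Whitehead group, where $K_1(R)=GL(R)/[GL(R),GL(R)]$ and $GL(R)=\bigcup_d GL_d(R)$. The group $\pi$ has \emph{Whitehead-trivial determinant} if $\ln\operatorname{Det}_\pi(A^*A)=0$ for every $d$ and every invertible matrix $A\in GL_d(\mathbb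 Z\pi)$ representing an element of $Wh(\pi)$. \textbf{Theorem.} The property of having Whitehead-trivial determinant is stable under directed direct limits, under directed inverse limits and under passage to subgroups. That is: \begin{enumerate} \item if $\pi=\varinjlim_{i\in I}\pi_i$ is the direct limit of a system of groups indexed by a (non-empty) directed set $I$, and every $\pi_i$ has Whitehead-trivial determinant, then so has $\pi$; \item if $\pi=\varprojlim_{i\in I}\pi_i$ is the inverse limit of an inverse system of groups indexed by a (non-empty) directed set $I$, and every $\pi_i$ has Whitehead-trivial determinant, then so has $\pi$; \item if $\pi$ has Whitehead-trivial determinant, then so has every subgroup $U<\pi$. \end{enumerate} The structure maps of the systems are arbitrary group homomorphisms. -/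

import Mathlib

universe u w

open scoped InnerProductSpace

noncomputable section

namespace GroupDet

/-! ### The Whitehead group -/

section Whitehead

variable {R : Type*} [Ring R]

/-- The `n × m` matrix of the standard inclusion `R ^ m → R ^ n`. -/
def incl (R : Type*) [Ring R] (n m : ℕ) : Matrix (Fin n) (Fin m) R :=
  fun i j => if (i : ℕ) = j then 1 else 0

lemma incl_apply_mul {n m : ℕ} {κ : Type*} (A : Matrix (Fin m) κ R) (i : Fin n)
    (j : κ) :
    (incl R n m * A) i j = if hi : (i : ℕ) < m then A ⟨i, hi⟩ j else 0 := by
  rw [Matrix.mul_apply]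
  split_ifs with hi
  · rw [Finset.sum_eq_single ⟨i, hi⟩]
    · simp [incl]
    · intro b _ hb
      have : (i : ℕ) ≠ b := fun h' => hb (Fin.ext h'.symm)
      simp [incl, this]
    · simp
  · refine Finset.sum_eq_zero fun b _ => ?_
    have : (i : ℕ) ≠ b := by omega
    simp [incl, this]

lemma incl_mul_incl {m n k : ℕ} (hmn : m ≤ n) :
    incl R k n * incl R n m = incl R k m := by
  ext i j
  rw [incl_apply_mul]
  split_ifs with hi
  · rfl
  · have : (i : ℕ) ≠ j := by omega
    simp [incl, this]

lemma incl_transpose (n m : ℕ) : (incl R n m).transpose = incl R m n := by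
  ext i j
  simp [incl, Matrix.transpose_apply, eq_comm]

lemma incl_self (n : ℕ) : incl R n n = 1 := by
  ext i j
  simp [incl, Matrix.one_apply, Fin.ext_iff]

lemma incl_mul_incl_self {m n : ℕ} (h : m ≤ n) : incl R m n * incl R n m = 1 := by
  ext i j
  rw [Matrix.mul_apply, Finset.sum_eq_single (Fin.castLE h i)]
  · simp [incl, Matrix.one_apply, Fin.ext_iff]
  · intro b _ hb
    have : (i : ℕ) ≠ b := fun h' => hb (Fin.ext h'.symm)
    simp [incl, this]
  · simp

lemma incl_mul_incl' {m n k : ℕ} (hmn : m ≤ n) :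
    incl R m n * incl R n k = incl R m k := by
  ext i j
  rw [Matrix.mul_apply, Finset.sum_eq_single (Fin.castLE hmn i)]
  · simp [incl]
  · intro b _ hb
    have : (i : ℕ) ≠ b := fun h' => hb (Fin.ext h'.symm)
    simp [incl, this]
  · simp

/-- For `m ≤ n`, the block matrix `A ⊕ 1` of size `n`, i.e. `A - 1` extended by zero, plus `1`
(see `stabMatrix_apply` for the entries). -/
def stabMatrix (m n : ℕ) (A : Matrix (Fin m) (Fin m) R) : Matrix (Fin n) (Fin n) R :=
  1 + incl R n m * (A - 1) * incl R m n

lemma stabMatrix_apply {m n : ℕ} (A : Matrix (Fin m) (Fin m) R) (i j : Fin n) :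
    stabMatrix m n A i j =
      if hij : (i : ℕ) < m ∧ (j : ℕ) < m then A ⟨i, hij.1⟩ ⟨j, hij.2⟩
      else if i = j then 1 else 0 := by
  rw [stabMatrix, Matrix.add_apply, Matrix.mul_assoc, incl_apply_mul, Matrix.one_apply]
  by_cases hi : (i : ℕ) < m
  · rw [dif_pos hi, Matrix.mul_apply]
    by_cases hj : (j : ℕ) < m
    · rw [Finset.sum_eq_single ⟨j, hj⟩]
      · simp [incl, hi, hj, Matrix.one_apply, Fin.ext_iff]
      · intro b _ hb
        have : (b : ℕ) ≠ j := fun h' => hb (Fin.ext h')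
        simp [incl, this]
      · simp
    · rw [Finset.sum_eq_zero]
      · simp [hj]
      · intro b _
        have : (b : ℕ) ≠ j := by omega
        simp [incl, this]
  · simp [hi]

lemma stabMatrix_one (m n : ℕ) : stabMatrix m n (1 : Matrix (Fin m) (Fin m) R) = 1 := by
  simp [stabMatrix]

lemma stabMatrix_mul {m n : ℕ} (h : m ≤ n) (A B : Matrix (Fin m) (Fin m) R) :
    stabMatrix m n (A * B) = stabMatrix m n A * stabMatrix m n B := by
  have key : incl R n m * (A - 1) * incl R m n * (incl R n m * (B - 1) * incl R m n) =
      incl R n m * ((A - 1) * (B - 1)) * incl R m n := by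
    calc _ = incl R n m * (A - 1) * (incl R m n * incl R n m) * (B - 1) * incl R m n := by
          simp only [Matrix.mul_assoc]
      _ = _ := by rw [incl_mul_incl_self h]; simp only [Matrix.mul_assoc, Matrix.one_mul]
  simp only [stabMatrix]
  rw [add_mul, mul_add, mul_add, key]
  have : A * B - 1 = (A - 1) + (B - 1) + (A - 1) * (B - 1) := by noncomm_ring
  rw [this]
  simp only [Matrix.mul_add, Matrix.add_mul, one_mul, mul_one]
  abel

/-- Stabilization `GL_m(R) → GL_n(R)`, `A ↦ A ⊕ 1`, for `m ≤ n`. -/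
def stab (R : Type*) [Ring R] (m n : ℕ) (h : m ≤ n) :
    (Matrix (Fin m) (Fin m) R)ˣ →* (Matrix (Fin n) (Fin n) R)ˣ :=
  Units.map
    { toFun := stabMatrix m n
      map_one' := stabMatrix_one m n
      map_mul' := stabMatrix_mul h }

instance stab_directedSystem (R : Type*) [Ring R] :
    DirectedSystem (fun n : ℕ => (Matrix (Fin n) (Fin n) R)ˣ) (stab R · · ·) where
  map_self i x := by
    ext1
    change stabMatrix i i (x : Matrix (Fin i) (Fin i) R) = x
    simp [stabMatrix, incl_self]
  map_map k j i hij hjk x := by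
    ext1
    change stabMatrix j k (stabMatrix i j (x : Matrix (Fin i) (Fin i) R)) =
      stabMatrix i k (x : Matrix (Fin i) (Fin i) R)
    simp only [stabMatrix, add_sub_cancel_left]
    rw [← incl_mul_incl (R := R) hij (k := k), ← incl_mul_incl' (R := R) hij (k := k)]
    simp only [Matrix.mul_assoc]

/-- The stable general linear group `GL(R) = colim_n GL_n(R)`. -/
abbrev StableGL (R : Type*) [Ring R] : Type _ :=
  DirectLimit (fun n : ℕ => (Matrix (Fin n) (Fin n) R)ˣ) (stab R)

/-- `K₁(R) = GL(R) / [GL(R), GL(R)]`. -/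
abbrev K1 (R : Type*) [Ring R] : Type _ := Abelianization (StableGL R)

/-- The class in `K₁(R)` of an invertible matrix. -/
def K1.mk {d : ℕ} (A : (Matrix (Fin d) (Fin d) R)ˣ) : K1 R :=
  Abelianization.of (⟦⟨d, A⟩⟧ : StableGL R)

/-- The invertible `1 × 1` matrix with entry a unit. -/
def unitMatrix (r : Rˣ) : (Matrix (Fin 1) (Fin 1) R)ˣ :=
  Units.map (Matrix.scalar (Fin 1) : R →+* Matrix (Fin 1) (Fin 1) R).toMonoidHom r

/-- A group element as a unit of the integral group ring. -/
def groupUnit {π : Type*} [Group π] (g : π) : (MonoidAlgebra ℤ π)ˣ :=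
  Units.map (MonoidAlgebra.of ℤ π) (toUnits g)

/-- The subgroup of `K₁(ℤπ)` generated by the classes of the trivial units `±g`, `g ∈ π`. -/
def trivialUnits (π : Type*) [Group π] : Subgroup (K1 (MonoidAlgebra ℤ π)) :=
  Subgroup.closure
    {x | ∃ g : π, x = K1.mk (unitMatrix (groupUnit g)) ∨
      x = K1.mk (unitMatrix (-groupUnit g))}

/-- The Whitehead group `Wh(π) = K₁(ℤπ) / {±g}`. -/
abbrev Wh (π : Type*) [Group π] : Type _ := K1 (MonoidAlgebra ℤ π) ⧸ trivialUnits π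

/-- The class in `Wh(π)` of an invertible matrix over `ℤπ`. -/
def Wh.mk {π : Type*} [Group π] {d : ℕ}
    (A : (Matrix (Fin d) (Fin d) (MonoidAlgebra ℤ π))ˣ) : Wh π :=
  QuotientGroup.mk (K1.mk A)

end Whitehead

/-! ### Matrices over the group ring as operators on `l²(π)^d` -/

section Operators

variable (π : Type*) [Group π]

/-- The Hilbert space `l²(π)`. -/
abbrev L2 : Type _ := lp (fun _ : π => ℂ) 2

/-- The Hilbert space `l²(π)^d`. -/
abbrev L2Pow (d : ℕ) : Type _ := PiLp 2 (fun _ : Fin d => L2 π)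

variable {π}

lemma memℓp_translate (g : π) (v : L2 π) : Memℓp (fun h : π => v (g⁻¹ * h)) 2 := by
  have hv := lp.memℓp v
  rw [memℓp_gen_iff (by norm_num)] at hv ⊢
  exact hv.comp_injective (mul_right_injective g⁻¹)

/-- Left translation by `g` on `l²(π)`: `(g v)(h) = v(g⁻¹ h)`, so that `g δ_h = δ_{gh}`. -/
def translate (g : π) : L2 π →ₗᵢ[ℂ] L2 π where
  toFun v := ⟨fun h => v (g⁻¹ * h), memℓp_translate g v⟩
  map_add' _ _ := rfl
  map_smul' _ _ := rfl
  norm_map' v := by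
    have h2 : 0 < (2 : ENNReal).toReal := by norm_num
    rw [lp.norm_eq_tsum_rpow h2, lp.norm_eq_tsum_rpow h2]
    congr 1
    exact (Equiv.mulLeft g⁻¹).tsum_eq (fun h => ‖v h‖ ^ (2 : ENNReal).toReal)

/-- The left regular representation of `π` on `l²(π)`. -/
def leftRegular (π : Type*) [Group π] : π →* (L2 π →L[ℂ] L2 π) where
  toFun g := (translate g).toContinuousLinearMap
  map_one' := by
    ext v h
    change v (1⁻¹ * h) = v h
    simp
  map_mul' a b := by
    ext v h
    change v ((a * b)⁻¹ * h) = v (b⁻¹ * (a⁻¹ * h))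
    simp [mul_assoc]

/-- The integral group ring acting on `l²(π)` by multiplication from the left. -/
def groupRingOp (π : Type*) [Group π] : MonoidAlgebra ℤ π →ₐ[ℤ] (L2 π →L[ℂ] L2 π) :=
  MonoidAlgebra.lift ℤ (L2 π →L[ℂ] L2 π) π (leftRegular π)

/-- A matrix over `ℤπ` acting on `l²(π)^d` by multiplication from the left:
`(A v)_i = ∑ j, a_{ij} v_j`. -/
def matrixOp {d : ℕ} (A : Matrix (Fin d) (Fin d) (MonoidAlgebra ℤ π)) :
    L2Pow π d →L[ℂ] L2Pow π d :=
  (PiLp.continuousLinearEquiv 2 ℂ (fun _ : Fin d => L2 π)).symm.toContinuousLinearMap ∘L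
    ContinuousLinearMap.pi fun i =>
      ∑ j, groupRingOp π (A i j) ∘L PiLp.proj 2 (fun _ : Fin d => L2 π) j

/-- The vector `δ_1 e_k` of `l²(π)^d`. -/
def basisVec (π : Type*) [Group π] {d : ℕ} (k : Fin d) : L2Pow π d :=
  open Classical in PiLp.single 2 k (lp.single 2 (1 : π) (1 : ℂ))

end Operators

/-! ### Spectral density function and regularized determinant -/

section Determinant

variable {H : Type*} [NormedAddCommGroup H] [InnerProductSpace ℂ H] [CompleteSpace H]

/-- For self-adjoint `T`, the kernel of the positive part `(T - t)⁺`. -/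
def spectralSubspace (T : H →L[ℂ] H) (t : ℝ) : Submodule ℂ H :=
  LinearMap.ker (cfc (fun s : ℝ => max (s - t) 0) T : H →L[ℂ] H).toLinearMap

instance (T : H →L[ℂ] H) (t : ℝ) : (spectralSubspace T t).HasOrthogonalProjection := by
  have : CompleteSpace (spectralSubspace T t) :=
    (ContinuousLinearMap.isClosed_ker
      (cfc (fun s : ℝ => max (s - t) 0) T : H →L[ℂ] H)).completeSpace_coe
  infer_instance

/-- The spectral projection `χ_{(-∞, t]}(T)` of a self-adjoint operator `T`: the orthogonal
projection onto the kernel of `(T - t)⁺`. For positive `T` (so that the spectrum lies in `[0, ∞)`)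
this is `χ_{[0, t]}(T)`. (These projections form the spectral family of `T`.) -/
def spectralProj (T : H →L[ℂ] H) (t : ℝ) : H →L[ℂ] H :=
  (spectralSubspace T t).starProjection

lemma spectralSubspace_mono (T : H →L[ℂ] H) : Monotone (spectralSubspace T) := by
  intro a b hab
  rcases hab.eq_or_lt with rfl | hlt
  · exact le_rfl
  have hden : ∀ s : ℝ, max (s - a) (b - a) ≠ 0 := fun s =>
    (lt_of_lt_of_le (sub_pos.2 hlt) (le_max_right _ _)).ne'
  have hfac : (fun s : ℝ => max (s - b) 0) =
      fun s => (max (s - b) 0 / max (s - a) (b - a)) * max (s - a) 0 := by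
    funext s
    rcases le_total s b with h | h
    · simp [max_eq_right (sub_nonpos.2 h)]
    · have h1 : max (s - a) (b - a) = s - a := max_eq_left (by linarith)
      have h2 : max (s - a) 0 = s - a := max_eq_left (by linarith)
      have h3 : s - a ≠ 0 := by linarith
      rw [h1, h2, div_mul_cancel₀ _ h3]
  intro x hx
  simp only [spectralSubspace, LinearMap.mem_ker] at hx ⊢
  by_cases hT : IsSelfAdjoint T
  · rw [hfac, cfc_mul (fun s : ℝ => max (s - b) 0 / max (s - a) (b - a))
      (fun s : ℝ => max (s - a) 0) T
      (Continuous.continuousOn (Continuous.div (by fun_prop) (by fun_prop) hden))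
      (Continuous.continuousOn (by fun_prop))]
    change (cfc (fun s : ℝ => max (s - b) 0 / max (s - a) (b - a)) T)
      ((cfc (fun s : ℝ => max (s - a) 0) T) x) = 0
    erw [hx]
    simp
  · rw [cfc_apply_of_not_predicate T hT]
    simp

variable {ι : Type*} [Fintype ι]

/-- The functional `T ↦ ∑ k, (T e_k, e_k)` given by finitely many vectors `e_k`. For
`e_k = basisVec π k` in `l²(π)^d` and an operator matrix `T = (a_{ij})` over the group von Neumann
algebra this is the von Neumann trace `tr_π(T) = ∑ i, (a_{ii} 1, 1)`. -/
def vecTrace (e : ι → H) (T : H →L[ℂ] H) : ℂ :=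
  ∑ k, ⟪e k, T (e k)⟫_ℂ

/-- The spectral density function `F_T(t) = tr χ_{[0, t]}(T)`, for the trace `vecTrace e`. -/
def specDens (e : ι → H) (T : H →L[ℂ] H) (t : ℝ) : ℝ :=
  (vecTrace e (spectralProj T t)).re

lemma specDens_mono (e : ι → H) (T : H →L[ℂ] H) : Monotone (specDens e T) := by
  intro a b hab
  have hle : spectralProj T a ≤ spectralProj T b :=
    Submodule.starProjection_le_starProjection_iff.2 (spectralSubspace_mono T hab)
  simp only [specDens, vecTrace, Complex.re_sum]
  refine Finset.sum_le_sum fun k _ => ?_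
  have h := (ContinuousLinearMap.le_def _ _).1 hle
  have h2 := h.re_inner_nonneg_right (e k)
  simp only [sub_apply, inner_sub_right, map_sub] at h2
  simpa using h2

/-- The Lebesgue-Stieltjes measure `dF_T` of the monotone, right-continuous function `F_T`. -/
def specMeasure (e : ι → H) (T : H →L[ℂ] H) : MeasureTheory.Measure ℝ :=
  (specDens_mono e T).stieltjesFunction.measure

open Classical in
/-- The logarithm of the regularized determinant of a positive operator `T` with respect to the
trace `vecTrace e`: `∫_{0⁺}^∞ ln t dF_T(t)` if this integral converges, and `-∞` otherwise. -/
def lnDetOf (e : ι → H) (T : H →L[ℂ] H) : EReal :=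
  if MeasureTheory.IntegrableOn Real.log (Set.Ioi 0) (specMeasure e T) then
    ((∫ t in Set.Ioi (0 : ℝ), Real.log t ∂(specMeasure e T) : ℝ) : EReal)
  else ⊥

/-- The regularized (Fuglede-Kadison) determinant `ln Det_π(T)` of a positive operator `T` on
`l²(π)^d`, formed with the von Neumann trace `tr_π`. -/
def lnDet {π : Type*} [Group π] {d : ℕ} (T : L2Pow π d →L[ℂ] L2Pow π d) : EReal :=
  lnDetOf (H := L2Pow π d) (basisVec π) T

/-- The group `π` has Whitehead-trivial determinant: `ln Det_π(A* A) = 0` for all invertible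
matrices `A` over `ℤπ` representing elements of `Wh(π)`. -/
def WhiteheadTrivialDet (π : Type*) [Group π] : Prop :=
  ∀ x : Wh π, ∀ (d : ℕ) (A : (Matrix (Fin d) (Fin d) (MonoidAlgebra ℤ π))ˣ), Wh.mk A = x →
    lnDet (ContinuousLinearMap.adjoint (matrixOp A.val) ∘L matrixOp A.val) = 0

end Determinant

/-! ### Stability of properties of groups -/

section Stability

/-- `C` holds for `π` whenever `π` is (isomorphic to) the direct limit of a directed system of
groups with property `C`. -/
def StableUnderDirectLimits (C : ∀ (π : Type u) [Group π], Prop) : Prop :=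
  ∀ (I : Type w) [Preorder I] [IsDirectedOrder I] [Nonempty I]
    (G : I → Type u) [∀ i, Group (G i)] (f : ∀ i j, i ≤ j → G i →* G j)
    [DirectedSystem G (f · · ·)] (π : Type u) [Group π],
    (π ≃* DirectLimit G f) → (∀ i, C (G i)) → C π

/-- The inverse limit of a system of groups `G i` with structure maps `f i j : G j → G i` for
`i ≤ j`: the group of compatible families. -/
def invLimit {I : Type*} [Preorder I] (G : I → Type*) [∀ i, Group (G i)]
    (f : ∀ i j, i ≤ j → G j →* G i) : Subgroup (∀ i, G i) where
  carrier := {x | ∀ i j (h : i ≤ j), f i j h (x j) = x i}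
  one_mem' := by intro i j h; simp
  mul_mem' := by intro x y hx hy i j h; simp [hx i j h, hy i j h]
  inv_mem' := by intro x hx i j h; simp [hx i j h]

/-- `C` holds for `π` whenever `π` is (isomorphic to) the inverse limit of an inverse system of
groups with property `C` over a directed index set. -/
def StableUnderInverseLimits (C : ∀ (π : Type u) [Group π], Prop) : Prop :=
  ∀ (I : Type w) [Preorder I] [IsDirectedOrder I] [Nonempty I]
    (G : I → Type u) [∀ i, Group (G i)] (f : ∀ i j, i ≤ j → G j →* G i),
    (∀ i, f i i le_rfl = MonoidHom.id (G i)) →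
    (∀ i j k (hij : i ≤ j) (hjk : j ≤ k),
      (f i j hij).comp (f j k hjk) = f i k (hij.trans hjk)) →
    ∀ (π : Type u) [Group π], (π ≃* invLimit G f) → (∀ i, C (G i)) → C π

/-- Every subgroup of a group with property `C` has property `C`. -/
def SubgroupStable (C : ∀ (π : Type u) [Group π], Prop) : Prop :=
  ∀ (π : Type u) [Group π] (U : Subgroup π), C π → C U

end Stability

end GroupDet

end

/-! For an invertible `A` over the group ring, the spectrum of `A* A` is compact in `(0, ∞)`, so the
determinant integral converges and `ln Det(A* A)` is the trace of `ln(A* A)`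
(`lnDetOf_eq_logTrace`). On a compact interval of `(0, ∞)`, `ln` is uniformly approximated by
polynomials, so this number is determined up to a small error by the traces of finitely many powers
of `A* A`. Each such trace is a sum of identity coefficients of group ring elements.

Now push `A` forward along two homomorphisms `φ`, `ψ` of the group. The norms of the images of `A`
and `A⁻¹` are bounded independently of the homomorphism, so one interval and one polynomial serve
both (`exists_spectrum_gramOp_mapMatrix_subset`). The identity coefficients agree as soon as `φ` and
`ψ` kill the same elements of a certain finite set. Hence if the kernel of `φ` can be matched on
every finite set by some `ψ` into a group with Whitehead-trivial determinant, the determinant of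
`φ(A)` vanishes (`lnDet_gramOp_mapMatrix_eq_zero`).

For subgroups `ψ` is the inclusion; for inverse limits it is a projection to a sufficiently late
stage. For direct limits an invertible matrix is first lifted to an invertible matrix over some
stage (`exists_unit_mapMatrix_eq`), and `ψ` is a structure map from that stage to a later one. -/

noncomputable section

namespace GroupDet

/-! ### The determinant as the trace of the logarithm, and its polynomial approximation. -/

section SpectralMeasure

open MeasureTheory Filter Topology
open scoped CompactlySupported

variable {H : Type*} [NormedAddCommGroup H] [InnerProductSpace ℂ H] [CompleteSpace H]
variable {ι : Type*} [Fintype ι]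

/-- The real part of `vecTrace e` as a real-linear functional. -/
def reTrace (e : ι → H) : (H →L[ℂ] H) →ₗ[ℝ] ℝ where
  toFun T := (vecTrace e T).re
  map_add' S T := by simp [vecTrace, Finset.sum_add_distrib]
  map_smul' r T := by
    have h (k : ι) : ⟪e k, (r • T) (e k)⟫_ℂ = r * ⟪e k, T (e k)⟫_ℂ := by
      rw [smul_apply, ← Complex.coe_smul, inner_smul_right]
    simp only [vecTrace, h, ← Finset.mul_sum, Complex.re_ofReal_mul, RingHom.id_apply, smul_eq_mul]

omit [CompleteSpace H] in
lemma reTrace_apply (e : ι → H) (T : H →L[ℂ] H) :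
    reTrace e T = ∑ k, (⟪e k, T (e k)⟫_ℂ).re := by
  simp [reTrace, vecTrace]

omit [CompleteSpace H] in
lemma reTrace_mono (e : ι → H) {S T : H →L[ℂ] H} (h : S ≤ T) : reTrace e S ≤ reTrace e T := by
  simp only [reTrace_apply]
  refine Finset.sum_le_sum fun k _ => ?_
  have h2 := ((ContinuousLinearMap.le_def _ _).1 h).re_inner_nonneg_right (e k)
  simp only [sub_apply, inner_sub_right, map_sub] at h2
  simpa using h2

-- This turns a uniform error on the spectrum into an error of traces.
omit [CompleteSpace H] in
lemma abs_reTrace_le (e : ι → H) (he : ∀ k, ‖e k‖ = 1) (T : H →L[ℂ] H) :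
    |reTrace e T| ≤ Fintype.card ι * ‖T‖ := by
  rw [reTrace_apply]
  refine (Finset.abs_sum_le_sum_abs _ _).trans ?_
  have h (k : ι) : |(⟪e k, T (e k)⟫_ℂ).re| ≤ ‖T‖ := by
    refine (Complex.abs_re_le_norm _).trans ((norm_inner_le_norm _ _).trans ?_)
    simpa [he k] using T.le_opNorm (e k)
  simpa using Finset.sum_le_sum (s := Finset.univ) fun k _ => h k

/-- The measure representing the functional `f ↦ reTrace e (f(T))`. -/
lemma exists_spectral_measure (e : ι → H) {T : H →L[ℂ] H} (hT : IsSelfAdjoint T) :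
    ∃ ν : Measure ℝ, IsFiniteMeasure ν ∧ (∀ᵐ x ∂ν, x ∈ spectrum ℝ T) ∧
      ∀ f : ℝ → ℝ, ContinuousOn f (spectrum ℝ T) → ∫ x, f x ∂ν = reTrace e (cfc f T) := by
  have hK : IsCompact (spectrum ℝ T) := spectrum.isCompact T
  have : CompactSpace (spectrum ℝ T) := isCompact_iff_compactSpace.1 hK
  -- Riesz–Markov–Kakutani on the compact spectrum, where every continuous function has compact
  -- support; the measure is then pushed forward to the line.
  let Λ : C_c(spectrum ℝ T, ℝ) →ₚ[ℝ] ℝ := PositiveLinearMap.mk₀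
    { toFun := fun f => reTrace e (cfcHom hT f.toContinuousMap)
      map_add' := fun f g => by
        rw [← map_add, ← map_add]; rfl
      map_smul' := fun r f => by
        rw [RingHom.id_apply, ← map_smul, ← map_smul]; rfl }
    (fun f hf => by
      have h0 : (0 : H →L[ℂ] H) ≤ cfcHom hT f.toContinuousMap :=
        (cfcHom_nonneg_iff hT).2 fun x => hf x
      simpa using reTrace_mono e h0)
  let μ := RealRMK.rieszMeasure Λ
  have hμ : IsFiniteMeasure μ := ⟨isCompact_univ.measure_lt_top⟩
  refine ⟨μ.map Subtype.val, inferInstance, ?_, fun f hf => ?_⟩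
  · exact (ae_map_iff measurable_subtype_coe.aemeasurable hK.measurableSet).2
      (.of_forall fun x => x.2)
  · rw [(MeasurableEmbedding.subtype_coe hK.measurableSet).integral_map]
    have := RealRMK.integral_rieszMeasure Λ
      (CompactlySupportedContinuousMap.continuousMapEquiv ⟨_, hf.domRestrict⟩)
    rw [cfc_apply f T hT hf]
    exact this

lemma isStarProjection_spectralProj (T : H →L[ℂ] H) (t : ℝ) :
    IsStarProjection (spectralProj T t) :=
  isStarProjection_starProjection

lemma cfc_mul_spectralProj (T : H →L[ℂ] H) (t : ℝ) :
    cfc (fun x : ℝ => max (x - t) 0) T * spectralProj T t = 0 := by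
  ext x
  exact (spectralSubspace T t).starProjection_apply_mem x

/-- `χ_{(-∞, s]}(T) ≤ f(T)` if `f ≥ 0` equals `1` on `(-∞, s]`. -/
lemma spectralProj_le_cfc {T : H →L[ℂ] H} (hT : IsSelfAdjoint T) {s : ℝ} {f g : ℝ → ℝ}
    (hf : Continuous f) (hf0 : ∀ x, 0 ≤ f x) (hg : Continuous g)
    (hfg : ∀ x, f x + g x * max (x - s) 0 = 1) :
    spectralProj T s ≤ cfc f T := by
  have hP := isStarProjection_spectralProj T s
  -- The projection `P` maps onto the kernel of `(T - s)⁺`, so multiplying this identity by `P` on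
  -- the right leaves `f(T) P = P`.
  have hsum : cfc f T + cfc g T * cfc (fun x : ℝ => max (x - s) 0) T = 1 := by
    rw [← cfc_mul g _ T hg.continuousOn (by fun_prop),
      ← cfc_add (a := T) f _ hf.continuousOn (by fun_prop), ← cfc_one ℝ T]
    exact cfc_congr fun x _ => hfg x
  have h1 : cfc f T * spectralProj T s = spectralProj T s := by
    have h := congrArg (· * spectralProj T s) hsum
    simpa only [add_mul, mul_assoc, cfc_mul_spectralProj, mul_zero, add_zero, one_mul] using h
  have h2 : spectralProj T s * cfc f T = spectralProj T s := by
    have h := congrArg star h1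
    rwa [star_mul, hP.isSelfAdjoint.star_eq, (cfc_predicate f T).star_eq] at h
  -- The difference is a compression of the positive operator `f(T)`, hence positive.
  have h3 : (1 - spectralProj T s) * cfc f T * (1 - spectralProj T s) =
      cfc f T - spectralProj T s := by
    simp only [sub_mul, mul_sub, one_mul, mul_one, h1, h2, hP.isIdempotentElem.eq]
    abel
  rw [← sub_nonneg, ← h3]
  exact ((IsSelfAdjoint.one _).sub hP.isSelfAdjoint).conjugate_nonneg
    (cfc_nonneg fun x _ => hf0 x)

/-- `f(T) ≤ χ_{(-∞, t]}(T)` if `f ≤ 1` vanishes on `[t, ∞)`. -/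
lemma cfc_le_spectralProj {T : H →L[ℂ] H} {t : ℝ} {f : ℝ → ℝ}
    (hf : Continuous f) (hf1 : ∀ x, f x ≤ 1) (hft : ∀ x, t ≤ x → f x = 0) :
    cfc f T ≤ spectralProj T t := by
  have hP := isStarProjection_spectralProj T t
  -- `f` and `(x - t)⁺` have disjoint supports, so `f(T)` maps into the kernel of `(T - t)⁺`, which
  -- is the range of the projection.
  have h0 : cfc (fun x : ℝ => max (x - t) 0) T * cfc f T = 0 := by
    rw [← cfc_mul _ f T (by fun_prop) hf.continuousOn, ← cfc_zero ℝ T]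
    refine cfc_congr fun x _ => ?_
    rcases le_total t x with h | h
    · simp [hft x h]
    · simp [max_eq_right (sub_nonpos.2 h)]
  have h1 : spectralProj T t * cfc f T = cfc f T := by
    ext x
    refine (spectralSubspace T t).starProjection_eq_self_iff.2 ?_
    exact congrArg (fun S : H →L[ℂ] H => S x) h0
  have h2 : cfc f T * spectralProj T t = cfc f T := by
    have h := congrArg star h1
    rwa [star_mul, hP.isSelfAdjoint.star_eq, (cfc_predicate f T).star_eq] at h
  have h3 : spectralProj T t * (1 - cfc f T) * spectralProj T t =
      spectralProj T t - cfc f T := by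
    simp only [sub_mul, mul_sub, mul_one, h1, h2, hP.isIdempotentElem.eq]
  rw [← sub_nonneg, ← h3]
  exact hP.isSelfAdjoint.conjugate_nonneg (sub_nonneg.2 (cfc_le_one f T fun x _ => hf1 x))

/-- A continuous function equal to `1` on `(-∞, s]` and to `0` on `[t, ∞)`. -/
def cutoff (s t x : ℝ) : ℝ := 1 - (max (x - s) (t - s))⁻¹ * max (x - s) 0

lemma cutoff_eq_one {s t x : ℝ} (hx : x ≤ s) : cutoff s t x = 1 := by
  simp [cutoff, max_eq_right (sub_nonpos.2 hx)]

lemma cutoff_eq_zero {s t x : ℝ} (hst : s < t) (hx : t ≤ x) : cutoff s t x = 0 := by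
  have h : x - s ≠ 0 := by linarith
  rw [cutoff, max_eq_left (by linarith), max_eq_left (by linarith), inv_mul_cancel₀ h, sub_self]

lemma max_sub_pos {s t : ℝ} (hst : s < t) (x : ℝ) : 0 < max (x - s) (t - s) :=
  lt_max_of_lt_right (sub_pos.2 hst)

lemma cutoff_nonneg {s t : ℝ} (hst : s < t) (x : ℝ) : 0 ≤ cutoff s t x := by
  rw [cutoff, sub_nonneg, inv_mul_le_one₀ (max_sub_pos hst x)]
  exact max_le_max le_rfl (sub_nonneg.2 hst.le)

lemma cutoff_le_one {s t : ℝ} (hst : s < t) (x : ℝ) : cutoff s t x ≤ 1 := by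
  have := mul_nonneg (inv_nonneg.2 (max_sub_pos hst x).le) (le_max_right (x - s) 0)
  rw [cutoff]
  linarith

lemma continuous_inv_max {s t : ℝ} (hst : s < t) :
    Continuous fun x : ℝ => (max (x - s) (t - s))⁻¹ :=
  Continuous.inv₀ (by fun_prop) fun x => (max_sub_pos hst x).ne'

lemma continuous_cutoff {s t : ℝ} (hst : s < t) : Continuous (cutoff s t) :=
  continuous_const.sub ((continuous_inv_max hst).mul (by fun_prop))

/-- The spectral measure of a self-adjoint operator is the one representing
`f ↦ reTrace e (f(T))`. -/
lemma specMeasure_eq {e : ι → H} {T : H →L[ℂ] H} (hT : IsSelfAdjoint T) (ν : Measure ℝ)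
    [IsFiniteMeasure ν]
    (hν : ∀ f : ℝ → ℝ, ContinuousOn f (spectrum ℝ T) → ∫ x, f x ∂ν = reTrace e (cfc f T)) :
    specMeasure e T = ν := by
  have hint (s t : ℝ) (hst : s < t) : Integrable (cutoff s t) ν :=
    Integrable.of_bound (continuous_cutoff hst).aestronglyMeasurable 1
      (.of_forall fun x => by
        rw [Real.norm_of_nonneg (cutoff_nonneg hst x)]; exact cutoff_le_one hst x)
  -- The cutoff lies between the indicators of `(-∞, s]` and `(-∞, t]`, both for operators and for
  -- functions. This compares the two distribution functions only across a gap `s < t`, which right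
  -- limits close in `hF`.
  have hle (s t : ℝ) (hst : s < t) : specDens e T s ≤ ν.real (Set.Iic t) := by
    calc specDens e T s ≤ reTrace e (cfc (cutoff s t) T) :=
          reTrace_mono e (spectralProj_le_cfc hT (continuous_cutoff hst) (cutoff_nonneg hst)
            (continuous_inv_max hst) fun x => by simp [cutoff])
      _ = ∫ x, cutoff s t x ∂ν := (hν _ (continuous_cutoff hst).continuousOn).symm
      _ ≤ ∫ x, (Set.Iic t).indicator 1 x ∂ν := by
          refine integral_mono (hint s t hst)
            ((integrable_const (1 : ℝ)).indicator measurableSet_Iic) fun x => ?_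
          rcases le_or_gt x t with h | h
          · simpa [h] using cutoff_le_one hst x
          · simp [cutoff_eq_zero hst h.le, h]
      _ = ν.real (Set.Iic t) := integral_indicator_one measurableSet_Iic
  have hge (s t : ℝ) (hst : s < t) : ν.real (Set.Iic s) ≤ specDens e T t := by
    calc ν.real (Set.Iic s) = ∫ x, (Set.Iic s).indicator 1 x ∂ν :=
          (integral_indicator_one measurableSet_Iic).symm
      _ ≤ ∫ x, cutoff s t x ∂ν := by
          refine integral_mono ((integrable_const (1 : ℝ)).indicator measurableSet_Iic)
            (hint s t hst) fun x => ?_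
          rcases le_or_gt x s with h | h
          · simp [h, cutoff_eq_one]
          · simpa [h] using cutoff_nonneg hst x
      _ = reTrace e (cfc (cutoff s t) T) := hν _ (continuous_cutoff hst).continuousOn
      _ ≤ specDens e T t :=
          reTrace_mono e (cfc_le_spectralProj (continuous_cutoff hst) (cutoff_le_one hst)
            fun x hx => cutoff_eq_zero hst hx)
  have hright (t : ℝ) : Tendsto (fun x => ν.real (Set.Iic x)) (𝓝[>] t) (𝓝 (ν.real (Set.Iic t))) := by
    have h := tendsto_measure_biInter_gt (μ := ν) (s := fun x : ℝ => Set.Iic x) (a := t)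
      (fun _ _ => measurableSet_Iic.nullMeasurableSet) (fun _ _ _ h => Set.Iic_subset_Iic.2 h)
      ⟨t + 1, by simp, measure_ne_top _ _⟩
    have hI : ⋂ x > t, Set.Iic x = Set.Iic t := by
      ext y
      simpa using ⟨le_of_forall_gt_imp_ge_of_dense, fun h x hx => h.trans hx.le⟩
    rw [hI] at h
    exact (ENNReal.tendsto_toReal (measure_ne_top _ _)).comp h
  -- The Stieltjes function takes right limits of `specDens`, so right continuity of `specDens`
  -- itself need not be shown.
  have hF (t : ℝ) : (specDens_mono e T).stieltjesFunction t = ν.real (Set.Iic t) := by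
    rw [Monotone.stieltjesFunction_eq]
    refine le_antisymm ?_ ?_
    · refine ge_of_tendsto (hright t) ?_
      filter_upwards [self_mem_nhdsWithin] with y (hy : t < y)
      obtain ⟨x, htx, hxy⟩ := exists_between hy
      exact ((specDens_mono e T).rightLim_le htx).trans (hle x y hxy)
    · refine ge_of_tendsto ((specDens_mono e T).tendsto_rightLim t) ?_
      filter_upwards [self_mem_nhdsWithin] with x (hx : t < x)
      exact hge t x hx
  rw [specMeasure]
  refine Measure.ext_of_Ioc _ _ fun a b hab => ?_
  rw [StieltjesFunction.measure_Ioc, hF, hF, ← Set.Iic_sdiff_Iic,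
    measure_sdiff (Set.Iic_subset_Iic.2 hab.le) measurableSet_Iic.nullMeasurableSet
      (measure_ne_top _ _), measureReal_def, measureReal_def,
    ← ENNReal.toReal_sub_of_le (measure_mono (Set.Iic_subset_Iic.2 hab.le)) (measure_ne_top _ _),
    ENNReal.ofReal_toReal (ENNReal.sub_ne_top (measure_ne_top _ _))]

/-- The trace of `ln(T)`. -/
def logTrace (e : ι → H) (T : H →L[ℂ] H) : ℝ :=
  reTrace e (cfc Real.log T)

/-- For `T` self-adjoint with positive spectrum, `ln Det(T)` is the trace of `ln(T)`. -/
lemma lnDetOf_eq_logTrace (e : ι → H) {T : H →L[ℂ] H} (hT : IsSelfAdjoint T)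
    (hpos : ∀ x ∈ spectrum ℝ T, 0 < x) :
    lnDetOf e T = (logTrace e T : EReal) := by
  have hlog : ContinuousOn Real.log (spectrum ℝ T) :=
    Real.continuousOn_log.mono fun x hx => (hpos x hx).ne'
  obtain ⟨ν, hfin, hsupp, hν⟩ := exists_spectral_measure e hT
  -- With positive spectrum, restricting to `(0, ∞)` loses no mass, and `ln` is continuous on the
  -- compact set carrying `ν`; so the convergent case of the definition applies.
  have hrestr : ν.restrict (Set.Ioi 0) = ν :=
    Measure.restrict_eq_self_of_ae_mem (hsupp.mono fun x hx => hpos x hx)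
  have hint : Integrable Real.log ν := by
    have := hlog.integrableOn_compact (μ := ν) (spectrum.isCompact T)
    rwa [IntegrableOn, Measure.restrict_eq_self_of_ae_mem hsupp] at this
  rw [lnDetOf, specMeasure_eq hT ν hν, IntegrableOn, hrestr, if_pos hint, hν _ hlog, logTrace]

omit [CompleteSpace H] in
lemma reTrace_aeval (e : ι → H) (T : H →L[ℂ] H) (p : Polynomial ℝ) :
    reTrace e (Polynomial.aeval T p) =
      ∑ n ∈ Finset.range (p.natDegree + 1), p.coeff n * reTrace e (T ^ n) := by
  simp only [Polynomial.aeval_eq_sum_range, map_sum, map_smul, smul_eq_mul]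

/-- If `p` approximates `ln` on the spectrum of `T`, then the trace of `p(T)` approximates that
of `ln(T)`. -/
lemma abs_reTrace_aeval_sub_logTrace_le {e : ι → H} (he : ∀ k, ‖e k‖ = 1) {T : H →L[ℂ] H}
    (hT : IsSelfAdjoint T) (hpos : ∀ x ∈ spectrum ℝ T, 0 < x) {p : Polynomial ℝ} {ε : ℝ}
    (hε : 0 ≤ ε) (hp : ∀ x ∈ spectrum ℝ T, |p.eval x - Real.log x| ≤ ε) :
    |reTrace e (Polynomial.aeval T p) - logTrace e T| ≤ Fintype.card ι * ε := by
  have hlog : ContinuousOn Real.log (spectrum ℝ T) :=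
    Real.continuousOn_log.mono fun x hx => (hpos x hx).ne'
  rw [logTrace, ← cfc_polynomial p T hT, ← map_sub,
    ← cfc_sub (a := T) _ _ p.continuous.continuousOn hlog]
  refine (abs_reTrace_le e he _).trans ?_
  gcongr
  exact norm_cfc_le hε hp

/-- If a polynomial `p` approximates `ln` on the spectra of `T` and `T'` and the traces of
sufficiently many powers of `T` and `T'` agree, then the traces of `ln(T)` and `ln(T')` are
close to each other. -/
lemma abs_logTrace_sub_logTrace_le {H' : Type*} [NormedAddCommGroup H'] [InnerProductSpace ℂ H']
    [CompleteSpace H'] {e : ι → H} {e' : ι → H'} (he : ∀ k, ‖e k‖ = 1) (he' : ∀ k, ‖e' k‖ = 1)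
    {T : H →L[ℂ] H} {T' : H' →L[ℂ] H'} (hT : IsSelfAdjoint T) (hT' : IsSelfAdjoint T')
    {a b : ℝ} (ha : 0 < a) (hspec : spectrum ℝ T ⊆ Set.Icc a b)
    (hspec' : spectrum ℝ T' ⊆ Set.Icc a b) {p : Polynomial ℝ} {ε : ℝ} (hε : 0 ≤ ε)
    (hp : ∀ x ∈ Set.Icc a b, |p.eval x - Real.log x| ≤ ε)
    (h : ∀ n ∈ Finset.range (p.natDegree + 1), reTrace e (T ^ n) = reTrace e' (T' ^ n)) :
    |logTrace e T - logTrace e' T'| ≤ 2 * Fintype.card ι * ε := by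
  have h1 := abs_reTrace_aeval_sub_logTrace_le he hT (fun x hx => ha.trans_le (hspec hx).1) hε
    fun x hx => hp x (hspec hx)
  have h2 := abs_reTrace_aeval_sub_logTrace_le he' hT' (fun x hx => ha.trans_le (hspec' hx).1) hε
    fun x hx => hp x (hspec' hx)
  have heq : reTrace e (Polynomial.aeval T p) = reTrace e' (Polynomial.aeval T' p) := by
    rw [reTrace_aeval, reTrace_aeval]
    exact Finset.sum_congr rfl fun n hn => by rw [h n hn]
  rw [heq] at h1
  rw [abs_le] at h1 h2 ⊢
  constructor <;> linarith

end SpectralMeasure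

/-! ### Two-sided spectral bounds for `a* a` with `a` invertible. -/

section SpectrumBounds

variable {𝓐 : Type*} [CStarAlgebra 𝓐]

/-- If `a` is invertible with inverse `b` and `‖a‖, ‖b‖ ≤ K`, then the spectrum of `a* a` lies in
`[K⁻², K²]`. -/
lemma spectrum_star_mul_self_subset_Icc {a b : 𝓐} (hab : a * b = 1) (hba : b * a = 1) {K : ℝ}
    (hK : 0 < K) (ha : ‖a‖ ≤ K) (hb : ‖b‖ ≤ K) :
    spectrum ℝ (star a * a) ⊆ Set.Icc (K ^ 2)⁻¹ (K ^ 2) := by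
  -- Only an inequality, because the algebra may be zero, as it is for matrices of size `0`.
  have h1 : ‖(1 : 𝓐)‖ ≤ 1 := by
    rcases subsingleton_or_nontrivial 𝓐 with h | h
    · simp [Subsingleton.elim (1 : 𝓐) 0]
    · exact CStarRing.norm_one.le
  have bound {c : 𝓐} (hc : ‖c‖ ≤ K ^ 2) {x : ℝ} (hx : x ∈ spectrum ℝ c) : |x| ≤ K ^ 2 :=
    (spectrum.norm_le_norm_mul_of_mem hx).trans
      ((mul_le_of_le_one_right (norm_nonneg _) h1).trans hc)
  -- The lower bound comes from the inverse `b b*`: its norm is at most `K²` and its spectrum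
  -- contains `x⁻¹`.
  let u : 𝓐ˣ := ⟨star a * a, b * star b, by
      rw [mul_assoc, ← mul_assoc a, hab, one_mul, ← star_mul, hba, star_one], by
      rw [mul_assoc, ← mul_assoc (star b), ← star_mul, hab, star_one, one_mul, hba]⟩
  intro x hx
  have hxu : x ∈ spectrum ℝ (u : 𝓐) := hx
  have hx0 : 0 ≤ x := spectrum_star_mul_self_nonneg x hx
  have hne : x ≠ 0 := spectrum.ne_zero_of_mem_of_unit hxu
  have hle : |x| ≤ K ^ 2 := bound (by rw [CStarRing.norm_star_mul_self, sq]; gcongr) hx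
  have hinv : |x⁻¹| ≤ K ^ 2 :=
    bound (c := (u⁻¹ : 𝓐ˣ)) (by
      change ‖b * star b‖ ≤ _
      rw [CStarRing.norm_self_mul_star, sq]; gcongr) (spectrum.inv₀_mem_inv_iff.2 hxu)
  rw [abs_of_nonneg hx0] at hle
  rw [abs_of_nonneg (inv_nonneg.2 hx0)] at hinv
  exact ⟨inv_le_of_inv_le₀ (hx0.lt_of_ne' hne) hinv, hle⟩

end SpectrumBounds

/-! ### The group ring on `l²`: adjoints, traces and uniform norm bounds. -/

section GroupRing

variable {π : Type*} [Group π]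

lemma groupRingOp_single (g : π) (n : ℤ) :
    groupRingOp π (MonoidAlgebra.single g n) = n • leftRegular π g := by
  simp [groupRingOp]

lemma leftRegular_apply (g : π) (v : L2 π) (h : π) : leftRegular π g v h = v (g⁻¹ * h) := rfl

/-- Translation by `g` preserves inner products, so `(g⁻¹ x, y) = (g g⁻¹ x, g y) = (x, g y)`. -/
lemma adjoint_leftRegular (g : π) :
    ContinuousLinearMap.adjoint (leftRegular π g) = leftRegular π g⁻¹ := by
  refine ((ContinuousLinearMap.eq_adjoint_iff _ _).2 fun x y => ?_).symm
  rw [← (translate g).inner_map_map]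
  congr 1
  change (leftRegular π g * leftRegular π g⁻¹) x = x
  rw [← map_mul, mul_inv_cancel, map_one]
  rfl

lemma norm_leftRegular_le (g : π) : ‖leftRegular π g‖ ≤ 1 :=
  (translate g).norm_toContinuousLinearMap_le

lemma adjoint_groupRingOp (x : MonoidAlgebra ℤ π) :
    ContinuousLinearMap.adjoint (groupRingOp π x) =
      groupRingOp π (MonoidAlgebra.mapDomain (fun g => g⁻¹) x) := by
  induction x using MonoidAlgebra.induction_linear with
  | zero => simp
  | add x y hx hy => simp only [map_add, MonoidAlgebra.mapDomain_add, hx, hy]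
  | single g n =>
    rw [MonoidAlgebra.mapDomain_single, groupRingOp_single, groupRingOp_single, map_zsmul,
      adjoint_leftRegular]

/-- Pairing with `δ_1` evaluates at `1`. This makes the von Neumann trace a purely algebraic
quantity on the group ring. -/
lemma inner_groupRingOp_single_one [DecidableEq π] (x : MonoidAlgebra ℤ π) :
    ⟪(lp.single 2 (1 : π) (1 : ℂ) : L2 π), groupRingOp π x (lp.single 2 (1 : π) (1 : ℂ))⟫_ℂ =
      x.coeff 1 := by
  have h (y : L2 π) : ⟪(lp.single 2 (1 : π) (1 : ℂ) : L2 π), y⟫_ℂ = y 1 := by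
    rw [lp.inner_single_left]; simp
  rw [h]
  induction x using MonoidAlgebra.induction_linear with
  | zero => simp
  | add x y hx hy => simp [hx, hy]
  | single g n =>
    rw [groupRingOp_single]
    change n • leftRegular π g (lp.single 2 (1 : π) (1 : ℂ)) 1 = _
    rw [leftRegular_apply, lp.single_apply]
    by_cases hg : g = 1
    · simp [hg]
    · simp [hg]

/-- The operator norms of the images of a group ring element under all group homomorphisms are
uniformly bounded. -/
lemma exists_norm_groupRingOp_mapDomain_le (x : MonoidAlgebra ℤ π) :
    ∃ K : ℝ, ∀ (G : Type w) [Group G] (ψ : π →* G),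
      ‖groupRingOp G (MonoidAlgebra.mapDomainRingHom ℤ ψ x)‖ ≤ K := by
  induction x using MonoidAlgebra.induction_linear with
  | zero => exact ⟨0, fun G _ ψ => by simp⟩
  | add x y hx hy =>
    obtain ⟨K, hK⟩ := hx
    obtain ⟨L, hL⟩ := hy
    refine ⟨K + L, fun G _ ψ => ?_⟩
    rw [map_add, map_add]
    exact norm_add_le_of_le (hK G ψ) (hL G ψ)
  | single g n =>
    -- Translations have norm at most `1` in every group, so the bound sees neither `G` nor `ψ`.
    refine ⟨‖n‖, fun G _ ψ => ?_⟩
    rw [MonoidAlgebra.mapDomainRingHom_apply, MonoidAlgebra.mapDomain_single, groupRingOp_single]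
    refine (norm_zsmul_le _ _).trans ?_
    exact mul_le_of_le_one_right (norm_nonneg _) (norm_leftRegular_le _)

end GroupRing

/-! ### Matrices over the group ring: adjoints, traces and functoriality in the group. -/

section MatrixOp

variable {π : Type*} [Group π] {d : ℕ}

lemma matrixOp_apply (A : Matrix (Fin d) (Fin d) (MonoidAlgebra ℤ π)) (v : L2Pow π d)
    (i : Fin d) : matrixOp A v i = ∑ j, groupRingOp π (A i j) (v j) := by
  simp [matrixOp]

lemma matrixOp_one : matrixOp (1 : Matrix (Fin d) (Fin d) (MonoidAlgebra ℤ π)) = 1 := by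
  ext1 v
  refine PiLp.ext fun i => ?_
  rw [matrixOp_apply, Finset.sum_eq_single i]
  · simp
  · intro j _ hj
    simp [Matrix.one_apply_ne hj.symm]
  · simp

lemma matrixOp_mul (A B : Matrix (Fin d) (Fin d) (MonoidAlgebra ℤ π)) :
    matrixOp (A * B) = matrixOp A * matrixOp B := by
  ext1 v
  refine PiLp.ext fun i => ?_
  rw [mul_apply_eq_comp, matrixOp_apply, matrixOp_apply]
  simp only [matrixOp_apply, Matrix.mul_apply, map_sum, map_mul, sum_apply,
    mul_apply_eq_comp]
  exact Finset.sum_comm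

lemma matrixOp_pow (A : Matrix (Fin d) (Fin d) (MonoidAlgebra ℤ π)) (n : ℕ) :
    matrixOp (A ^ n) = matrixOp A ^ n := by
  induction n with
  | zero => simp [matrixOp_one]
  | succ n ih => rw [pow_succ, pow_succ, matrixOp_mul, ih]

/-- The conjugate transpose for the involution `g ↦ g⁻¹` of the group ring. -/
def conjTranspose (A : Matrix (Fin d) (Fin d) (MonoidAlgebra ℤ π)) :
    Matrix (Fin d) (Fin d) (MonoidAlgebra ℤ π) :=
  fun i j => MonoidAlgebra.mapDomain (fun g => g⁻¹) (A j i)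

lemma adjoint_matrixOp (A : Matrix (Fin d) (Fin d) (MonoidAlgebra ℤ π)) :
    ContinuousLinearMap.adjoint (matrixOp A) = matrixOp (conjTranspose A) := by
  refine ((ContinuousLinearMap.eq_adjoint_iff _ _).2 fun x y => ?_).symm
  simp only [PiLp.inner_apply, matrixOp_apply, sum_inner, inner_sum]
  rw [Finset.sum_comm]
  refine Finset.sum_congr rfl fun i _ => Finset.sum_congr rfl fun j _ => ?_
  rw [conjTranspose, ← adjoint_groupRingOp, ContinuousLinearMap.adjoint_inner_left]

lemma norm_basisVec (k : Fin d) : ‖basisVec π k‖ = 1 := by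
  classical
  rw [basisVec, PiLp.norm_single, lp.norm_single (by norm_num)]
  simp

/-- The von Neumann trace of a matrix over the group ring. -/
lemma reTrace_matrixOp (A : Matrix (Fin d) (Fin d) (MonoidAlgebra ℤ π)) :
    reTrace (basisVec π) (matrixOp A) = ∑ k, ((A k k).coeff 1 : ℝ) := by
  classical
  rw [reTrace_apply]
  refine Finset.sum_congr rfl fun k _ => ?_
  have h : ⟪basisVec π k, matrixOp A (basisVec π k)⟫_ℂ = ((A k k).coeff 1 : ℤ) := by
    have hs : matrixOp A (basisVec π k) k =
        groupRingOp π (A k k) (lp.single 2 (1 : π) (1 : ℂ)) := by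
      rw [matrixOp_apply, Finset.sum_eq_single k]
      · simp [basisVec]
      · intro j _ hj
        simp [basisVec, hj]
      · simp
    rw [PiLp.inner_apply, Finset.sum_eq_single k]
    · rw [hs, ← inner_groupRingOp_single_one (A k k)]
      simp [basisVec]
    · intro j _ hj
      simp [basisVec, hj]
    · simp
  rw [h]
  simp

lemma norm_piLp_le_sum {E : Type*} [NormedAddCommGroup E] (w : PiLp 2 fun _ : Fin d => E) :
    ‖w‖ ≤ ∑ i, ‖w i‖ := by
  rw [PiLp.norm_eq_of_L2]
  exact Real.sqrt_le_iff.2 ⟨by positivity, Finset.sum_sq_le_sq_sum_of_nonneg fun i _ => norm_nonneg _⟩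

/-- A crude bound suffices: it only has to transfer uniformity in the homomorphism from entries to
matrices. -/
lemma norm_matrixOp_le (A : Matrix (Fin d) (Fin d) (MonoidAlgebra ℤ π)) :
    ‖matrixOp A‖ ≤ ∑ i, ∑ j, ‖groupRingOp π (A i j)‖ := by
  refine ContinuousLinearMap.opNorm_le_bound _ (by positivity) fun v => ?_
  have h : ‖matrixOp A v‖ ≤ ∑ i, ‖matrixOp A v i‖ := norm_piLp_le_sum _
  refine h.trans ?_
  rw [Finset.sum_mul]
  refine Finset.sum_le_sum fun i _ => ?_
  rw [matrixOp_apply, Finset.sum_mul]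
  refine norm_sum_le_of_le _ fun j _ => ?_
  exact (groupRingOp π (A i j)).le_opNorm_of_le (PiLp.norm_apply_le v j)

/-- The image of a matrix over a group ring under a group homomorphism. -/
def mapMatrix {G : Type*} [Group G] (ψ : π →* G) :
    Matrix (Fin d) (Fin d) (MonoidAlgebra ℤ π) →+* Matrix (Fin d) (Fin d) (MonoidAlgebra ℤ G) :=
  (MonoidAlgebra.mapDomainRingHom ℤ ψ).mapMatrix

/-- Homomorphisms commute with inversion. Hence `A* A` of an image matrix is itself the image of one
fixed matrix over `ℤπ`. -/
lemma mapMatrix_conjTranspose {G : Type*} [Group G] (ψ : π →* G)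
    (A : Matrix (Fin d) (Fin d) (MonoidAlgebra ℤ π)) :
    mapMatrix ψ (conjTranspose A) = conjTranspose (mapMatrix ψ A) := by
  ext1 i j
  change MonoidAlgebra.mapDomain ψ (MonoidAlgebra.mapDomain _ (A j i)) =
    MonoidAlgebra.mapDomain _ (MonoidAlgebra.mapDomain ψ (A j i))
  generalize A j i = x
  induction x using MonoidAlgebra.induction_linear with
  | zero => simp
  | add x y hx hy => simp only [MonoidAlgebra.mapDomain_add, hx, hy]
  | single g n => simp

lemma exists_norm_matrixOp_mapMatrix_le (A : Matrix (Fin d) (Fin d) (MonoidAlgebra ℤ π)) :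
    ∃ K : ℝ, ∀ (G : Type w) [Group G] (ψ : π →* G), ‖matrixOp (mapMatrix ψ A)‖ ≤ K := by
  choose K hK using fun i j => exists_norm_groupRingOp_mapDomain_le.{w} (A i j)
  exact ⟨∑ i, ∑ j, K i j, fun G _ ψ => (norm_matrixOp_le _).trans
    (Finset.sum_le_sum fun i _ => Finset.sum_le_sum fun j _ => hK i j G ψ)⟩

lemma coeff_one_mapDomain {G : Type*} [Group G] [DecidableEq G] (φ : π →* G)
    (x : MonoidAlgebra ℤ π) :
    (MonoidAlgebra.mapDomain φ x).coeff 1 =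
      ∑ g ∈ x.coeff.support, if φ g = 1 then x.coeff g else 0 := by
  simp [MonoidAlgebra.mapDomain, Finsupp.mapDomain, Finsupp.sum, Finsupp.single_apply]

/-- The coefficient at `1` of the image of `x` under `ψ` only depends on which elements of the
support of `x` lie in the kernel of `ψ`. -/
lemma coeff_one_mapDomain_congr {G G' : Type*} [Group G] [Group G'] (φ : π →* G) (ψ : π →* G')
    (x : MonoidAlgebra ℤ π) (h : ∀ g ∈ x.coeff.support, φ g = 1 ↔ ψ g = 1) :
    (MonoidAlgebra.mapDomain φ x).coeff 1 = (MonoidAlgebra.mapDomain ψ x).coeff 1 := by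
  classical
  rw [coeff_one_mapDomain, coeff_one_mapDomain]
  exact Finset.sum_congr rfl fun g hg => if_congr (h g hg) rfl rfl

end MatrixOp

/-! ### The approximation theorem. -/

section Approximation

variable {π : Type*} [Group π] {d : ℕ}

/-- The operator `A* A` of a matrix `A` over the group ring. -/
def gramOp (A : Matrix (Fin d) (Fin d) (MonoidAlgebra ℤ π)) : L2Pow π d →L[ℂ] L2Pow π d :=
  star (matrixOp A) * matrixOp A

lemma gramOp_eq_matrixOp (A : Matrix (Fin d) (Fin d) (MonoidAlgebra ℤ π)) :
    gramOp A = matrixOp (conjTranspose A * A) := by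
  rw [gramOp, matrixOp_mul, ← adjoint_matrixOp]
  rfl

lemma isSelfAdjoint_gramOp (A : Matrix (Fin d) (Fin d) (MonoidAlgebra ℤ π)) :
    IsSelfAdjoint (gramOp A) :=
  IsSelfAdjoint.star_mul_self _

/-- The group ring elements on the right do not depend on `ψ`; only which elements of their supports
`ψ` kills affects the trace. -/
lemma reTrace_gramOp_mapMatrix_pow {G : Type*} [Group G] (ψ : π →* G)
    (A : Matrix (Fin d) (Fin d) (MonoidAlgebra ℤ π)) (n : ℕ) :
    reTrace (basisVec G) (gramOp (mapMatrix ψ A) ^ n) =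
      ∑ k, ((MonoidAlgebra.mapDomain ψ (((conjTranspose A * A) ^ n) k k)).coeff 1 : ℝ) := by
  rw [gramOp_eq_matrixOp, ← mapMatrix_conjTranspose, ← map_mul, ← matrixOp_pow, ← map_pow,
    reTrace_matrixOp]
  rfl

/-- The Whitehead class imposes no restriction, since every invertible matrix represents its own
class. -/
lemma WhiteheadTrivialDet.lnDet_gramOp {G : Type*} [Group G] (h : WhiteheadTrivialDet G)
    (A : (Matrix (Fin d) (Fin d) (MonoidAlgebra ℤ G))ˣ) : lnDet (gramOp A.val) = 0 :=
  h _ d A rfl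

/-- The spectra of the operators `A* A` of the images of an invertible matrix `A` under all group
homomorphisms are contained in a common compact subset of `(0, ∞)`. -/
lemma exists_spectrum_gramOp_mapMatrix_subset
    (A : (Matrix (Fin d) (Fin d) (MonoidAlgebra ℤ π))ˣ) :
    ∃ a b : ℝ, 0 < a ∧ ∀ (G : Type w) [Group G] (ψ : π →* G),
      spectrum ℝ (gramOp (mapMatrix ψ A.val)) ⊆ Set.Icc a b := by
  obtain ⟨K, hK⟩ := exists_norm_matrixOp_mapMatrix_le.{w} A.val
  obtain ⟨L, hL⟩ := exists_norm_matrixOp_mapMatrix_le.{w} (A⁻¹).val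
  -- The `1` secures positivity, as `K` and `L` are only upper bounds and could be `0`.
  have hpos : 0 < max 1 (max K L) := lt_max_of_lt_left one_pos
  refine ⟨_, max 1 (max K L) ^ 2, inv_pos.2 (pow_pos hpos 2), fun G _ ψ => ?_⟩
  refine spectrum_star_mul_self_subset_Icc (b := matrixOp (mapMatrix ψ (A⁻¹).val)) ?_ ?_ hpos
    ((hK G ψ).trans ((le_max_left _ _).trans (le_max_right _ _)))
    ((hL G ψ).trans ((le_max_right _ _).trans (le_max_right _ _)))
  · rw [← matrixOp_mul, ← map_mul, Units.mul_inv, map_one, matrixOp_one]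
  · rw [← matrixOp_mul, ← map_mul, Units.inv_mul, map_one, matrixOp_one]

/-- Let `φ : H → π` be a homomorphism such that on every finite subset of `H` the kernel of `φ`
agrees with the kernel of a homomorphism to a group with Whitehead-trivial determinant. Then
`ln Det(A* A) = 0` for the image `A` of an invertible matrix over `ℤH`. -/
theorem lnDet_gramOp_mapMatrix_eq_zero {H π : Type u} [Group H] [Group π] (φ : H →* π)
    (A : (Matrix (Fin d) (Fin d) (MonoidAlgebra ℤ H))ˣ)
    (h : ∀ S : Finset H, ∃ (G : Type u) (_ : Group G) (ψ : H →* G),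
      WhiteheadTrivialDet G ∧ ∀ g ∈ S, φ g = 1 ↔ ψ g = 1) :
    lnDet (gramOp (mapMatrix φ A.val)) = 0 := by
  classical
  obtain ⟨a, b, ha, hspec⟩ := exists_spectrum_gramOp_mapMatrix_subset.{u} A
  have hlnDet (G : Type u) [Group G] (ψ : H →* G) : lnDet (gramOp (mapMatrix ψ A.val)) =
      (logTrace (basisVec G) (gramOp (mapMatrix ψ A.val)) : EReal) :=
    lnDetOf_eq_logTrace _ (isSelfAdjoint_gramOp _) fun x hx => ha.trans_le (hspec G ψ hx).1
  rw [hlnDet, EReal.coe_eq_zero, ← abs_nonpos_iff]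
  refine le_of_forall_pos_le_add fun δ hδ => ?_
  -- Two approximations, each with `d` basis vectors, multiply the error by `2 * d`; the extra `1`
  -- keeps the denominator nonzero for `d = 0`.
  obtain ⟨p, hp⟩ := exists_polynomial_near_of_continuousOn a b Real.log
    (Real.continuousOn_log.mono fun x hx => (ha.trans_le hx.1).ne') (δ / (2 * d + 1))
    (by positivity)
  -- The finite set collects the supports of all diagonal entries of the powers of `A* A` up to the
  -- degree of `p`. It can be chosen before `ψ` because `p` works for all homomorphisms.
  obtain ⟨G, _, ψ, hG, hψ⟩ := h ((Finset.range (p.natDegree + 1)).biUnion fun n =>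
    Finset.univ.biUnion fun k => (((conjTranspose A.val * A.val) ^ n) k k).coeff.support)
  have hzero : logTrace (basisVec G) (gramOp (mapMatrix ψ A.val)) = 0 := by
    have h0 := hG.lnDet_gramOp (Units.map (mapMatrix ψ).toMonoidHom A)
    exact EReal.coe_eq_zero.1 ((hlnDet G ψ).symm.trans h0)
  have hle := abs_logTrace_sub_logTrace_le (norm_basisVec (π := π)) (norm_basisVec (π := G))
    (isSelfAdjoint_gramOp (mapMatrix φ A.val)) (isSelfAdjoint_gramOp (mapMatrix ψ A.val)) ha
    (hspec π φ) (hspec G ψ) (p := p) (ε := δ / (2 * d + 1)) (by positivity)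
    (fun x hx => (hp x hx).le) fun n hn => by
      rw [reTrace_gramOp_mapMatrix_pow, reTrace_gramOp_mapMatrix_pow]
      refine Finset.sum_congr rfl fun k _ => ?_
      rw [coeff_one_mapDomain_congr φ ψ]
      exact fun g hg => hψ g (Finset.mem_biUnion.2 ⟨n, hn, Finset.mem_biUnion.2 ⟨k, by simp, hg⟩⟩)
  rw [hzero, sub_zero, Fintype.card_fin] at hle
  refine hle.trans ?_
  rw [zero_add, mul_div_assoc', div_le_iff₀ (by positivity)]
  linarith

lemma mapMatrix_id (A : Matrix (Fin d) (Fin d) (MonoidAlgebra ℤ π)) :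
    mapMatrix (MonoidHom.id π) A = A := by
  simp [mapMatrix]

/-- A group whose finite subsets are separated from `1` by homomorphisms to groups with
Whitehead-trivial determinant has Whitehead-trivial determinant. -/
theorem whiteheadTrivialDet_of_forall_finset {π : Type u} [Group π]
    (h : ∀ S : Finset π, ∃ (G : Type u) (_ : Group G) (ψ : π →* G),
      WhiteheadTrivialDet G ∧ ∀ g ∈ S, g = 1 ↔ ψ g = 1) :
    WhiteheadTrivialDet π := by
  intro _ d A _
  have := lnDet_gramOp_mapMatrix_eq_zero (MonoidHom.id π) A h
  rwa [mapMatrix_id] at this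

end Approximation

/-! ### Subgroups and inverse limits. -/

theorem subgroupStable_whiteheadTrivialDet :
    SubgroupStable.{u} (fun π _ => WhiteheadTrivialDet π) := fun π _ U h =>
  whiteheadTrivialDet_of_forall_finset fun _ =>
    ⟨π, inferInstance, U.subtype, h, fun g _ => by simp⟩

theorem stableUnderInverseLimits_whiteheadTrivialDet :
    StableUnderInverseLimits.{u, w} (fun π _ => WhiteheadTrivialDet π) := by
  intro I _ _ _ G _ f _ _ π _ e h
  classical
  let pr (i : I) : π →* G i :=
    ((Pi.evalMonoidHom G i).comp (invLimit G f).subtype).comp e.toMonoidHom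
  have hf (i j : I) (hij : i ≤ j) (g : π) : f i j hij (pr j g) = pr i g := (e g).2 i j hij
  have hpr (g : π) (hg : ∀ i, pr i g = 1) : g = 1 :=
    e.map_eq_one_iff.1 (Subtype.ext (funext hg))
  refine whiteheadTrivialDet_of_forall_finset fun S => ?_
  suffices ∃ i, ∀ g ∈ S, pr i g = 1 → g = 1 by
    obtain ⟨i, hi⟩ := this
    exact ⟨G i, inferInstance, pr i, h i, fun g hg => ⟨fun h1 => by rw [h1, map_one], hi g hg⟩⟩
  -- A nontrivial element is nontrivial at some stage, and then at every later one; directedness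
  -- yields one stage for all of `S`.
  have hex (g : π) : ∃ i, pr i g = 1 → g = 1 := by
    by_cases hg : ∀ i, pr i g = 1
    · exact ⟨Classical.arbitrary I, fun _ => hpr g hg⟩
    · obtain ⟨i, hi⟩ := not_forall.1 hg
      exact ⟨i, fun h1 => absurd h1 hi⟩
  choose c hc using hex
  obtain ⟨i, hi⟩ := (S.image c).exists_le
  refine ⟨i, fun g hg h1 => hc g ?_⟩
  rw [← hf (c g) i (hi _ (Finset.mem_image_of_mem c hg)), h1, map_one]

/-! ### Lifting invertible matrices from a direct limit to a stage. -/

section DirectLimits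

variable {I : Type*} [Preorder I] [IsDirectedOrder I] [Nonempty I] {G : I → Type*}
  [∀ i, Group (G i)] {f : ∀ i j, i ≤ j → G i →* G j} {π : Type*} [Group π] {d : ℕ}

lemma mapMatrix_comp {G₁ G₂ G₃ : Type*} [Group G₁] [Group G₂] [Group G₃] (ψ : G₂ →* G₃)
    (φ : G₁ →* G₂) (A : Matrix (Fin d) (Fin d) (MonoidAlgebra ℤ G₁)) :
    mapMatrix (ψ.comp φ) A = mapMatrix ψ (mapMatrix φ A) := by
  simp only [mapMatrix, MonoidAlgebra.mapDomainRingHom_comp]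
  rfl

/-- Every element of the group ring of a direct limit comes from some stage. -/
lemma exists_mapDomainRingHom_eq (φ : ∀ i, G i →* π)
    (hφ : ∀ i j hij, (φ j).comp (f i j hij) = φ i) (hsurj : ∀ g, ∃ i x, φ i x = g)
    (x : MonoidAlgebra ℤ π) :
    ∃ i, ∀ j, i ≤ j → ∃ y, MonoidAlgebra.mapDomainRingHom ℤ (φ j) y = x := by
  induction x using MonoidAlgebra.induction_linear with
  | zero => exact ⟨Classical.arbitrary I, fun j _ => ⟨0, map_zero _⟩⟩
  | add x y hx hy =>
    obtain ⟨i, hi⟩ := hx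
    obtain ⟨k, hk⟩ := hy
    obtain ⟨l, hil, hkl⟩ := exists_ge_ge i k
    refine ⟨l, fun j hj => ?_⟩
    obtain ⟨x', rfl⟩ := hi j (hil.trans hj)
    obtain ⟨y', rfl⟩ := hk j (hkl.trans hj)
    exact ⟨x' + y', map_add _ _ _⟩
  | single g n =>
    obtain ⟨i, y, rfl⟩ := hsurj g
    refine ⟨i, fun j hj => ⟨MonoidAlgebra.single (f i j hj y) n, ?_⟩⟩
    rw [MonoidAlgebra.mapDomainRingHom_apply, MonoidAlgebra.mapDomain_single, ← hφ i j hj]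
    rfl

/-- Every matrix over the group ring of a direct limit comes from some stage. -/
lemma exists_mapMatrix_eq (φ : ∀ i, G i →* π)
    (hφ : ∀ i j hij, (φ j).comp (f i j hij) = φ i) (hsurj : ∀ g, ∃ i x, φ i x = g)
    (A : Matrix (Fin d) (Fin d) (MonoidAlgebra ℤ π)) :
    ∃ i, ∀ j, i ≤ j → ∃ B, mapMatrix (φ j) B = A := by
  classical
  choose c hc using fun p : Fin d × Fin d => exists_mapDomainRingHom_eq φ hφ hsurj (A p.1 p.2)
  obtain ⟨i, hi⟩ := (Finset.univ.image c).exists_le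
  refine ⟨i, fun j hj => ?_⟩
  choose B hB using fun p : Fin d × Fin d =>
    hc p j ((hi _ (Finset.mem_image_of_mem c (Finset.mem_univ p))).trans hj)
  exact ⟨fun k l => B (k, l), Matrix.ext fun k l => hB (k, l)⟩

/-- An element of the group ring of a stage that vanishes in the limit vanishes eventually. -/
lemma exists_mapDomainRingHom_eq_zero (φ : ∀ i, G i →* π)
    (hf : ∀ i j k hij hjk, (f j k hjk).comp (f i j hij) = f i k (hij.trans hjk))
    (hφ : ∀ i j hij, (φ j).comp (f i j hij) = φ i)
    (hinj : ∀ i x, φ i x = 1 → ∃ j, ∃ hij : i ≤ j, f i j hij x = 1) {i : I}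
    (x : MonoidAlgebra ℤ (G i)) (hx : MonoidAlgebra.mapDomainRingHom ℤ (φ i) x = 0) :
    ∃ j, i ≤ j ∧ ∀ k (hik : i ≤ k), j ≤ k →
      MonoidAlgebra.mapDomainRingHom ℤ (f i k hik) x = 0 := by
  classical
  -- Two elements identified in the limit are identified at a finite stage; for other pairs any
  -- stage will do. Finitely many pairs of support elements matter.
  have hex (p : G i × G i) : ∃ j, ∃ hij : i ≤ j, φ i p.1 = φ i p.2 →
      f i j hij p.1 = f i j hij p.2 := by
    by_cases h : φ i p.1 = φ i p.2
    · obtain ⟨j, hij, hj⟩ := hinj i (p.1 * p.2⁻¹) (by rw [map_mul, map_inv, h, mul_inv_cancel])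
      exact ⟨j, hij, fun _ => by rwa [map_mul, map_inv, mul_inv_eq_one] at hj⟩
    · exact ⟨i, le_rfl, fun h' => absurd h' h⟩
  choose c hic hc using hex
  let S := x.coeff.support
  obtain ⟨j₀, hj₀⟩ := ((S ×ˢ S).image c).exists_le
  obtain ⟨j, hij, hj₀j⟩ := exists_ge_ge i j₀
  refine ⟨j, hij, fun k hik hjk => ?_⟩
  -- From this stage on, passing to the limit merges no further support elements, so coefficients
  -- that cancel in the limit already cancel at stage `k`.
  have hinjOn : Set.InjOn (φ k) (f i k hik '' S) := by
    rintro _ ⟨g, hg, rfl⟩ _ ⟨h, hh, rfl⟩ hgh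
    have hk : c (g, h) ≤ k := (hj₀ _ (Finset.mem_image_of_mem c
      (Finset.mem_product.2 ⟨hg, hh⟩))).trans (hj₀j.trans hjk)
    have hgh' : φ i g = φ i h := by rw [← hφ i k hik]; exact hgh
    rw [← hf i _ k (hic (g, h)) hk]
    exact congrArg (f _ k hk) (hc (g, h) hgh')
  have h0 : Finsupp.mapDomain (φ k) (Finsupp.mapDomain (f i k hik) x.coeff) =
      Finsupp.mapDomain (φ k) 0 := by
    rw [← Finsupp.mapDomain_comp, Finsupp.mapDomain_zero, ← MonoidHom.coe_comp, hφ]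
    exact congrArg MonoidAlgebra.coeff hx
  refine MonoidAlgebra.coeff_injective (Finsupp.mapDomain_injOn _ hinjOn ?_ ?_ h0)
  · intro g hg
    obtain ⟨h, hh, rfl⟩ := Finset.mem_image.1 (Finsupp.mapDomain_support hg)
    exact ⟨h, hh, rfl⟩
  · simp

/-- A matrix over the group ring of a stage that vanishes in the limit vanishes eventually. -/
lemma exists_mapMatrix_eq_zero (φ : ∀ i, G i →* π)
    (hf : ∀ i j k hij hjk, (f j k hjk).comp (f i j hij) = f i k (hij.trans hjk))
    (hφ : ∀ i j hij, (φ j).comp (f i j hij) = φ i)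
    (hinj : ∀ i x, φ i x = 1 → ∃ j, ∃ hij : i ≤ j, f i j hij x = 1) {i : I}
    (A : Matrix (Fin d) (Fin d) (MonoidAlgebra ℤ (G i))) (hA : mapMatrix (φ i) A = 0) :
    ∃ j, i ≤ j ∧ ∀ k (hik : i ≤ k), j ≤ k → mapMatrix (f i k hik) A = 0 := by
  classical
  choose c hic hc using fun p : Fin d × Fin d => exists_mapDomainRingHom_eq_zero φ hf hφ hinj
    (A p.1 p.2) (congrFun (congrFun hA p.1) p.2)
  obtain ⟨j₀, hj₀⟩ := (Finset.univ.image c).exists_le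
  obtain ⟨j, hij, hj₀j⟩ := exists_ge_ge i j₀
  exact ⟨j, hij, fun k hik hjk => Matrix.ext fun p q => hc (p, q) k hik
    ((hj₀ _ (Finset.mem_image_of_mem c (Finset.mem_univ (p, q)))).trans (hj₀j.trans hjk))⟩

/-- Every invertible matrix over the group ring of a direct limit comes from an invertible matrix
over the group ring of some stage. -/
lemma exists_unit_mapMatrix_eq (φ : ∀ i, G i →* π)
    (hf : ∀ i j k hij hjk, (f j k hjk).comp (f i j hij) = f i k (hij.trans hjk))
    (hφ : ∀ i j hij, (φ j).comp (f i j hij) = φ i) (hsurj : ∀ g, ∃ i x, φ i x = g)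
    (hinj : ∀ i x, φ i x = 1 → ∃ j, ∃ hij : i ≤ j, f i j hij x = 1)
    (A : (Matrix (Fin d) (Fin d) (MonoidAlgebra ℤ π))ˣ) :
    ∃ i, ∃ B : (Matrix (Fin d) (Fin d) (MonoidAlgebra ℤ (G i)))ˣ, mapMatrix (φ i) B.val = A := by
  obtain ⟨i₁, hi₁⟩ := exists_mapMatrix_eq φ hφ hsurj A.val
  obtain ⟨i₂, hi₂⟩ := exists_mapMatrix_eq φ hφ hsurj (A⁻¹).val
  obtain ⟨i, h₁, h₂⟩ := exists_ge_ge i₁ i₂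
  obtain ⟨B, hB⟩ := hi₁ i h₁
  obtain ⟨C, hC⟩ := hi₂ i h₂
  -- Lifts of `A` and `A⁻¹` need not be inverse to each other, but both defects die in the limit,
  -- hence at a common later stage.
  obtain ⟨j₁, hij₁, hj₁⟩ := exists_mapMatrix_eq_zero φ hf hφ hinj (B * C - 1) (by
    rw [map_sub, map_mul, hB, hC, Units.mul_inv, map_one, sub_self])
  obtain ⟨j₂, hij₂, hj₂⟩ := exists_mapMatrix_eq_zero φ hf hφ hinj (C * B - 1) (by
    rw [map_sub, map_mul, hB, hC, Units.inv_mul, map_one, sub_self])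
  obtain ⟨j, hj₁j, hj₂j⟩ := exists_ge_ge j₁ j₂
  have hij := hij₁.trans hj₁j
  refine ⟨j, ⟨mapMatrix (f i j hij) B, mapMatrix (f i j hij) C, ?_, ?_⟩, ?_⟩
  · rw [← sub_eq_zero, ← hj₁ j hij hj₁j, map_sub, map_mul, map_one]
  · rw [← sub_eq_zero, ← hj₂ j hij hj₂j, map_sub, map_mul, map_one]
  · change mapMatrix (φ j) (mapMatrix (f i j hij) B) = A
    rw [← mapMatrix_comp, hφ, hB]

end DirectLimits

/-- The canonical homomorphism from a stage to the direct limit. -/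
def toDirectLimit {I : Type*} [Preorder I] [IsDirectedOrder I] [Nonempty I] (G : I → Type*)
    [∀ i, Group (G i)] (f : ∀ i j, i ≤ j → G i →* G j) [DirectedSystem G (f · · ·)] (i : I) :
    G i →* DirectLimit G f where
  toFun x := ⟦⟨i, x⟩⟧
  map_one' := (DirectLimit.one_def i).symm
  map_mul' x y := (DirectLimit.mul_def i x y).symm

theorem stableUnderDirectLimits_whiteheadTrivialDet :
    StableUnderDirectLimits.{u, w} (fun π _ => WhiteheadTrivialDet π) := by
  intro I _ _ _ G _ f _ π _ e h
  classical
  let φ (i : I) : G i →* π := e.symm.toMonoidHom.comp (toDirectLimit G f i)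
  have hf (i j k : I) (hij : i ≤ j) (hjk : j ≤ k) :
      (f j k hjk).comp (f i j hij) = f i k (hij.trans hjk) :=
    MonoidHom.ext fun x => DirectedSystem.map_map' f hij hjk x
  have hφ (i j : I) (hij : i ≤ j) : (φ j).comp (f i j hij) = φ i :=
    MonoidHom.ext fun x => congrArg e.symm (DirectLimit.mk_apply i j x hij)
  have hsurj (g : π) : ∃ i x, φ i x = g := by
    obtain ⟨i, x, hx⟩ := DirectLimit.exists_eq_mk f (e g)
    exact ⟨i, x, e.symm_apply_eq.2 hx.symm⟩
  have hinj (i : I) (x : G i) (hx : φ i x = 1) : ∃ j, ∃ hij : i ≤ j, f i j hij x = 1 := by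
    have hx' : (⟦⟨i, x⟩⟧ : DirectLimit G f) = ⟦⟨i, 1⟩⟧ :=
      (e.symm.map_eq_one_iff.1 hx).trans (DirectLimit.one_def i)
    obtain ⟨j, hij, _, hj⟩ := Quotient.exact hx'
    exact ⟨j, hij, hj.trans (map_one _)⟩
  intro _ d A _
  obtain ⟨i, B, hB⟩ := exists_unit_mapMatrix_eq φ hf hφ hsurj hinj A
  -- The map `φ i` need not be injective, so its kernel on `S` is matched with that of a structure
  -- map `f i j`: elements of `S` dying in the limit die by stage `j`, and the others survive
  -- because `φ i` factors through `f i j`.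
  have key := lnDet_gramOp_mapMatrix_eq_zero (φ i) B fun S => ?_
  · rwa [hB] at key
  have hex (g : G i) : ∃ j, ∃ hij : i ≤ j, φ i g = 1 → f i j hij g = 1 := by
    by_cases hg : φ i g = 1
    · obtain ⟨j, hij, hj⟩ := hinj i g hg
      exact ⟨j, hij, fun _ => hj⟩
    · exact ⟨i, le_rfl, fun h' => absurd h' hg⟩
  choose c hic hc using hex
  obtain ⟨j₀, hj₀⟩ := (S.image c).exists_le
  obtain ⟨j, hij, hj₀j⟩ := exists_ge_ge i j₀
  refine ⟨G j, inferInstance, f i j hij, h j, fun g hg => ⟨fun h1 => ?_, fun h1 => ?_⟩⟩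
  · have hcj : c g ≤ j := (hj₀ _ (Finset.mem_image_of_mem c hg)).trans hj₀j
    rw [← hf i (c g) j (hic g) hcj, MonoidHom.comp_apply, hc g h1, map_one]
  · rw [← hφ i j hij, MonoidHom.comp_apply, h1, map_one]

end GroupDet

end

theorem mainTheorem4 :
    GroupDet.StableUnderDirectLimits.{u, w} (fun π _ => GroupDet.WhiteheadTrivialDet π) ∧
    GroupDet.StableUnderInverseLimits.{u, w} (fun π _ => GroupDet.WhiteheadTrivialDet π) ∧
    GroupDet.SubgroupStable.{u} (fun π _ => GroupDet.WhiteheadTrivialDet π) :=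
  ⟨GroupDet.stableUnderDirectLimits_whiteheadTrivialDet,
    GroupDet.stableUnderInverseLimits_whiteheadTrivialDet,
    GroupDet.subgroupStable_whiteheadTrivialDet⟩
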